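/- **Proposition 3 (conditional expectation).** Let $H$ be a separable infinite-dimensional real Hilbert space (for example $L^2([0,1])$) with orthonormal basis $(e_j)_{j\ge 1}$, let $n\in\mathbb N$, and let $H^n$ be the product Hilbert space. Let $\mathbf X=(\mathbf X_1,\dots,\mathbf X_n)$ and $\mathbf Y=(\mathbf Y_1,\dots,\mathbf Y_n)$ be jointly Gaussian random variables with values in $H^n$. Let $\Sigma_{\mathbf X\mathbf Y}$ be the bounded operator on $H^n$ with $$\langle \Sigma_{\mathbf X\mathbf Y}h,k\rangle=E\big[\langle \mathbf X-E[\mathbf X],h\rangle\,\langle \mathbf Y-E[\mathbf Y],k\rangle\big],\qquad h,k\in H^n,$$ let $\Sigma_{\mathbf X}=\Sigma_{\mathbf X\mathbf X}$ be the covariance operator of $\mathbf X$, and let $\Sigma_{\mathbf X}^{1/2}$ be its positive square root. For $A\in\{\Sigma_{\mathbf X},\Sigma_{\mathbf X}^{1/2}\}$ let $A^{-1}$ be the inverse of $A$ defined on the range of $A$ (if $A$ is not injective, the inverse of the restriction of $A$ to $(\ker A)^\perp$). A *measurable linear transformation* with respect to a probability measure $\nu$ on $H^n$ is a linear map $L:D_L\to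 H^n$, where $D_L\subseteq H^n$ is a measurable linear subspace with $\nu(D_L)=1$ and $L$ is measurable on $D_L$. Then: 1. The operator $T=\Sigma_{\mathbf X\mathbf Y}\Sigma_{\mathbf X}^{-1/2}$, defined on the range of $\Sigma_{\mathbf X}^{1/2}$, is Hilbert–Schmidt, that is, it is the restriction of a Hilbert–Schmidt operator on $H^n$. 2. The operator $\Sigma_{\mathbf X\mathbf Y}\Sigma_{\mathbf X}^{-1}$, defined on the range of $\Sigma_{\mathbf X}$, has an extension to a measurable linear transformation with respect to the law of $\mathbf X-E[\mathbf X]$. 3. For every such extension, again denoted by $\Sigma_{\mathbf X\mathbf Y}\Sigma_{\mathbf X}^{-1}$, almost surely $\mathbf X-E[\mathbf X]$ lies in its domain, $$E[\mathbf Y\mid\mathbf X]=E[\mathbf Y]+\Sigma_{\mathbf X\mathbf Y}\Sigma_{\mathbf X}^{-1}\big(\mathbf X-E[\mathbf X]\big),$$ and this is the almost sure limit in $H^n$, as $m\to\infty$, of the conditional expectations $E[\mathbf Y\mid \bar X^1,\dots,\bar X^m]$ given the finitely many coordinates $\bar X^j=(\langle \mathbf X_1,e_j\rangle,\dots,\langle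 \mathbf X_n,e_j\rangle)\in\mathbb R^n$, $1\le j\le m$. -/

import Mathlib

open MeasureTheory ProbabilityTheory Filter Topology

noncomputable section

namespace GaussCond

/-- The product `H^n` with its Hilbert space structure `⟪x, y⟫ = ∑ i, ⟪x i, y i⟫`. -/
abbrev HPow (H : Type*) (n : ℕ) : Type _ := PiLp 2 (fun _ : Fin n => H)

section Covariance

variable {Ω E F : Type*} [MeasurableSpace Ω]
  [NormedAddCommGroup E] [InnerProductSpace ℝ E]
  [NormedAddCommGroup F] [InnerProductSpace ℝ F]

/-- The cross-covariance operator
`Σ_XY = E[ ⟪X - E X, ·⟫ (Y - E Y) ]`, that is,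
`⟪Σ_XY h, k⟫ = E[ ⟪X - E X, h⟫ ⟪Y - E Y, k⟫ ]`. -/
def crossCov (P : Measure Ω) (X : Ω → E) (Y : Ω → F) : E →L[ℝ] F :=
  ∫ ω, (innerSL ℝ (X ω - ∫ ω', X ω' ∂P)).smulRight (Y ω - ∫ ω', Y ω' ∂P) ∂P

/-- The covariance operator `Σ_X = Σ_XX`. -/
def cov (P : Measure Ω) (X : Ω → E) : E →L[ℝ] E := crossCov P X X

/-- The defining property of the cross-covariance operator, for square integrable variables. -/
theorem inner_crossCov [CompleteSpace E] [CompleteSpace F]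
    (P : Measure Ω) [IsProbabilityMeasure P] (X : Ω → E) (Y : Ω → F)
    (hX : MemLp X 2 P) (hY : MemLp Y 2 P) (h : E) (k : F) :
    inner ℝ (crossCov P X Y h) k =
      ∫ ω, inner ℝ (X ω - ∫ ω', X ω' ∂P) h * inner ℝ (Y ω - ∫ ω', Y ω' ∂P) k ∂P := by
  have hX' : MemLp (fun ω => X ω - ∫ ω', X ω' ∂P) 2 P := hX.sub (memLp_const _)
  have hY' : MemLp (fun ω => Y ω - ∫ ω', Y ω' ∂P) 2 P := hY.sub (memLp_const _)
  have hint : Integrable (fun ω => (innerSL ℝ (X ω - ∫ ω', X ω' ∂P)).smulRight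
      (Y ω - ∫ ω', Y ω' ∂P)) P := by
    refine Integrable.mono' (hX'.norm.integrable_mul hY'.norm) ?_ ?_
    · have hc : Continuous (fun p : E × F => (innerSL ℝ p.1).smulRight p.2) := by
        have h1 : Continuous (fun p : E × F =>
            ContinuousLinearMap.smulRightL ℝ E F (innerSL ℝ p.1) p.2) := by fun_prop
        exact h1
      exact hc.comp_aestronglyMeasurable
        (hX'.aestronglyMeasurable.prodMk hY'.aestronglyMeasurable)
    · filter_upwards with ω
      rw [ContinuousLinearMap.norm_smulRight_apply, innerSL_apply_norm]
      rfl
  have h2 := hint.apply_continuousLinearMap h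
  rw [crossCov, ContinuousLinearMap.integral_apply hint, real_inner_comm, ← integral_inner h2]
  refine integral_congr_ae (Eventually.of_forall fun ω => ?_)
  simp only [ContinuousLinearMap.smulRight_apply, innerSL_apply_apply, inner_smul_right,
    real_inner_comm]

end Covariance

section Operators

variable {E F : Type*} [NormedAddCommGroup E] [InnerProductSpace ℝ E]
  [NormedAddCommGroup F] [InnerProductSpace ℝ F]

/-- The (in general unbounded) inverse `A⁻¹` of a bounded operator `A`, with domain `range A`:
it sends `A x` to `x` for `x ∈ (ker A)ᗮ`. If `A` is injective this is the ordinary inverse of `A`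
on its range, see `opInv_domain` and `opInv_apply`. -/
def opInv (A : E →L[ℝ] E) : E →ₗ.[ℝ] E :=
  ((A : E →ₗ[ℝ] E).toPMap (LinearMap.ker (A : E →ₗ[ℝ] E))ᗮ).inverse

theorem opInv_ker (A : E →L[ℝ] E) :
    LinearMap.ker ((A : E →ₗ[ℝ] E).toPMap (LinearMap.ker (A : E →ₗ[ℝ] E))ᗮ).toFun = ⊥ := by
  rw [LinearMap.ker_eq_bot']
  rintro ⟨x, hx⟩ h0
  have h1 : x ∈ LinearMap.ker (A : E →ₗ[ℝ] E) := h0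
  have h2 : inner ℝ x x = 0 := (Submodule.mem_orthogonal _ _).1 hx x h1
  exact Subtype.ext (inner_self_eq_zero.1 h2)

theorem opInv_domain [CompleteSpace E] (A : E →L[ℝ] E) :
    (opInv A).domain = LinearMap.range (A : E →ₗ[ℝ] E) := by
  rw [opInv, LinearPMap.inverse_domain]
  ext y
  constructor
  · rintro ⟨⟨x, hx⟩, rfl⟩
    exact ⟨x, rfl⟩
  · rintro ⟨x, rfl⟩
    have hc : IsClosed (LinearMap.ker (A : E →ₗ[ℝ] E) : Set E) := A.isClosed_ker
    have : CompleteSpace (LinearMap.ker (A : E →ₗ[ℝ] E)) := hc.completeSpace_coe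
    obtain ⟨u, hu, v, hv, rfl⟩ :=
      Submodule.exists_add_mem_mem_orthogonal (K := LinearMap.ker (A : E →ₗ[ℝ] E)) x
    refine ⟨⟨v, hv⟩, ?_⟩
    have hu' : A u = 0 := hu
    change A v = A (u + v)
    rw [map_add, hu', zero_add]

theorem opInv_apply (A : E →L[ℝ] E) (hA : Function.Injective A) (x : E)
    (hx : A x ∈ (opInv A).domain) : opInv A ⟨A x, hx⟩ = x := by
  have hk : LinearMap.ker (A : E →ₗ[ℝ] E) = ⊥ := LinearMap.ker_eq_bot.2 hA
  have hm : x ∈ (LinearMap.ker (A : E →ₗ[ℝ] E))ᗮ := by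
    rw [hk, Submodule.bot_orthogonal_eq_top]; trivial
  exact LinearPMap.inverse_apply_eq (opInv_ker A) (y := ⟨A x, hx⟩) (x := ⟨x, hm⟩) rfl

/-- The product `C A⁻¹`, with domain `range A`. -/
def mulInv (C : E →L[ℝ] F) (A : E →L[ℝ] E) : E →ₗ.[ℝ] F :=
  (C : E →ₗ[ℝ] F).compPMap (opInv A)

/-- `S` is the positive square root of `A`. -/
def IsPosSqrt (S A : E →L[ℝ] E) : Prop := S.IsPositive ∧ S ∘L S = A

/-- A bounded operator is Hilbert–Schmidt: `∑ ‖A b_i‖² < ∞` for an orthonormal basis `b`. -/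
def IsHilbertSchmidt (A : E →L[ℝ] F) : Prop :=
  ∃ (s : Set E) (b : HilbertBasis s ℝ E), Summable fun i => ‖A (b i)‖ ^ 2

/-- A partially defined operator is Hilbert–Schmidt: it is the restriction to its domain of
an everywhere defined Hilbert–Schmidt operator. -/
def IsHilbertSchmidtPMap (T : E →ₗ.[ℝ] F) : Prop :=
  ∃ A : E →L[ℝ] F, IsHilbertSchmidt A ∧ ∀ x : T.domain, T x = A x

/-- A measurable linear transformation with respect to a measure `ν` on `E`: a linear map,
defined and measurable on a measurable linear subspace of full `ν`-measure. -/
def IsMeasurableLinear [MeasurableSpace E] [MeasurableSpace F]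
    (ν : Measure E) (L : E →ₗ.[ℝ] F) : Prop :=
  MeasurableSet (L.domain : Set E) ∧ ν (L.domain : Set E)ᶜ = 0 ∧
    Measurable (fun x : L.domain => L x)

end Operators

section Coordinates

variable {Ω H : Type*} [NormedAddCommGroup H] [InnerProductSpace ℝ H]

/-- The σ-algebra generated by the first `m` blocks of coordinates
`(⟪X_1, e_j⟫, …, ⟪X_n, e_j⟫)`, `j < m`, of `X` in the basis `e` of `H`. -/
abbrev coordSigma {n : ℕ} (e : HilbertBasis ℕ ℝ H) (X : Ω → HPow H n) (m : ℕ) :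
    MeasurableSpace Ω :=
  MeasurableSpace.comap
    (fun ω (j : Fin m) (i : Fin n) => (inner ℝ (X ω i) (e j) : ℝ)) inferInstance

end Coordinates

end GaussCond

end

/-! Centre the variables as `Z = X - E X`, `V = Y - E Y`, and let `A h = ⟪Z, h⟫`, `B k = ⟪V, k⟫` be
the associated operators into L²(P). Then Σ_X = A†A and Σ_XY = B†A, so the claims become Hilbert
space geometry in L²(P).

Hilbert–Schmidt: a square root S of A†A satisfies ‖S x‖ = ‖A x‖, so A = U S with U a contraction,
and Σ_XY S⁻¹ is a restriction of B†U. Here ∑ ‖B c_j‖² ≤ E‖V‖² by Bessel.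

Extension: for W_m spanned by the first m coordinate blocks, a finite-rank R_m makes A R_m A† the
projection onto A W_m. With T_m = B†A R_m, the residual V - T_m Z is uncorrelated with the
projection of Z to W_m, hence independent of it by Gaussianity, so T_m Z is the conditional
expectation. Lévy's upward theorem (`tendsto_ae_condExp_banach`) gives T_m Z → E[V | Z] almost
surely, and L = lim T_m is the extension: T_m A†A h = B† proj(A h) → B†A h. This is
`exists_regression`.

Uniqueness (`ae_eq_zero_of_isMeasurableLinear`): the difference M of two extensions vanishes on the
range of A†A, so M Z = M (Z - A†A R_m Z) is independent of every finite projection of Z, hence of Z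
and of itself. By the zero-one law and the symmetry of Z it vanishes. -/

noncomputable section

namespace GaussCond

/-! ### Square roots of positive operators by polynomial iteration -/

section SquareRoot

open Polynomial

/-- The polynomials `q` with `q 0 = 0` and `q (k + 1) = (X + (q k) ^ 2) / 2`, which converge to
`1 - √(1 - X)`. -/
def sqrtPoly : ℕ → ℝ[X]
  | 0 => 0
  | k + 1 => C (1 / 2) * (X + sqrtPoly k ^ 2)

/-- All coefficients of the polynomial are nonnegative. -/
def NonnegCoeff (p : ℝ[X]) : Prop := ∀ i, 0 ≤ p.coeff i

theorem NonnegCoeff.add {p q : ℝ[X]} (hp : NonnegCoeff p) (hq : NonnegCoeff q) :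
    NonnegCoeff (p + q) := fun i => by
  rw [coeff_add]; exact add_nonneg (hp i) (hq i)

theorem NonnegCoeff.mul {p q : ℝ[X]} (hp : NonnegCoeff p) (hq : NonnegCoeff q) :
    NonnegCoeff (p * q) := fun i => by
  rw [coeff_mul]; exact Finset.sum_nonneg fun x _ => mul_nonneg (hp _) (hq _)

theorem nonnegCoeff_C {c : ℝ} (hc : 0 ≤ c) : NonnegCoeff (C c) := fun i => by
  rw [coeff_C]; split_ifs <;> simp [hc]

theorem nonnegCoeff_X : NonnegCoeff X := fun i => by
  rw [coeff_X]; split_ifs <;> simp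

theorem nonnegCoeff_sqrtPoly (k : ℕ) : NonnegCoeff (sqrtPoly k) := by
  induction k with
  | zero => intro i; simp [sqrtPoly]
  | succ k ih =>
    rw [sqrtPoly, pow_two]
    exact (nonnegCoeff_C (by norm_num)).mul (nonnegCoeff_X.add (ih.mul ih))

/-- The recursion makes the next increment a difference of squares, half of (q_{k+1} + q_k)(q_{k+1}
- q_k). With nonnegative coefficients, increments at a contraction are bounded by increments at 1,
which telescope. -/
theorem nonnegCoeff_sqrtPoly_sub (k : ℕ) : NonnegCoeff (sqrtPoly (k + 1) - sqrtPoly k) := by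
  induction k with
  | zero =>
    rw [show sqrtPoly (0 + 1) - sqrtPoly 0 = C (1 / 2) * X by simp [sqrtPoly]]
    exact (nonnegCoeff_C (by norm_num)).mul nonnegCoeff_X
  | succ k ih =>
    have h : sqrtPoly (k + 1 + 1) - sqrtPoly (k + 1) =
        C (1 / 2) * ((sqrtPoly (k + 1) + sqrtPoly k) * (sqrtPoly (k + 1) - sqrtPoly k)) := by
      conv_lhs => rw [sqrtPoly]; arg 2; rw [sqrtPoly]
      ring
    rw [h]
    exact (nonnegCoeff_C (by norm_num)).mul
      (((nonnegCoeff_sqrtPoly _).add (nonnegCoeff_sqrtPoly _)).mul ih)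

theorem eval_one_sqrtPoly_le (k : ℕ) : (sqrtPoly k).eval 1 ≤ 1 := by
  have h0 : ∀ k, 0 ≤ (sqrtPoly k).eval 1 := fun k => by
    rw [eval_eq_sum]
    exact Finset.sum_nonneg fun i _ => by simpa using nonnegCoeff_sqrtPoly k i
  induction k with
  | zero => simp [sqrtPoly]
  | succ k ih =>
    simp only [sqrtPoly, eval_mul, eval_C, eval_add, eval_X, eval_pow]
    nlinarith [h0 k]

variable {E K : Type*} [NormedAddCommGroup E] [InnerProductSpace ℝ E]
  [NormedAddCommGroup K] [InnerProductSpace ℝ K]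

theorem NonnegCoeff.norm_aeval_le {p : ℝ[X]} (hp : NonnegCoeff p) {B : E →L[ℝ] E}
    (hB : ‖B‖ ≤ 1) : ‖aeval B p‖ ≤ p.eval 1 := by
  have hpow : ∀ i : ℕ, ‖B ^ i‖ ≤ 1 := fun i => by
    induction i with
    | zero => rw [pow_zero]; exact ContinuousLinearMap.norm_id_le
    | succ i ih =>
      rw [pow_succ]
      exact (norm_mul_le _ _).trans (mul_le_one₀ ih (norm_nonneg _) hB)
  rw [aeval_eq_sum_range, eval_eq_sum_range]
  refine (norm_sum_le _ _).trans (Finset.sum_le_sum fun i _ => ?_)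
  rw [norm_smul, Real.norm_of_nonneg (hp i), one_pow]
  exact mul_le_mul_of_nonneg_left (hpow i) (hp i)

/-- A self-adjoint contraction `B` solves `T = (B + T ^ 2) / 2` for a self-adjoint contraction
`T`; then `1 - T` is a square root of `1 - B`. -/
theorem exists_sq_add_eq_two_smul [CompleteSpace E] {B : E →L[ℝ] E} (hB : ‖B‖ ≤ 1) (hsa : IsSelfAdjoint B) :
    ∃ T : E →L[ℝ] E, IsSelfAdjoint T ∧ ‖T‖ ≤ 1 ∧ B + T ^ 2 = (2 : ℝ) • T := by
  set u : ℕ → E →L[ℝ] E := fun k => aeval B (sqrtPoly k) with hu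
  have hsucc : ∀ k, u (k + 1) = (1 / 2 : ℝ) • (B + u k ^ 2) := fun k => by
    simp only [hu, sqrtPoly, map_mul, map_add, map_pow, aeval_X, aeval_C, Algebra.smul_def]
  have husa : ∀ k, IsSelfAdjoint (u k) := fun k => by
    induction k with
    | zero => simp [hu, sqrtPoly]
    | succ k ih =>
      rw [hsucc]
      exact (IsSelfAdjoint.all _).smul (hsa.add (ih.pow 2))
  have hnorm : ∀ k, ‖u k‖ ≤ 1 := fun k =>
    ((nonnegCoeff_sqrtPoly k).norm_aeval_le hB).trans (eval_one_sqrtPoly_le k)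
  have hd : ∀ k, dist (u k) (u k.succ) ≤ (sqrtPoly (k + 1)).eval 1 - (sqrtPoly k).eval 1 := by
    intro k
    rw [dist_comm, dist_eq_norm, ← eval_sub]
    simpa [hu] using (nonnegCoeff_sqrtPoly_sub k).norm_aeval_le hB
  have hsum : Summable fun k => (sqrtPoly (k + 1)).eval 1 - (sqrtPoly k).eval 1 := by
    refine summable_of_sum_range_le (c := 1) (fun k => dist_nonneg.trans (hd k)) fun k => ?_
    rw [Finset.sum_range_sub fun k => (sqrtPoly k).eval 1]
    simpa [sqrtPoly] using eval_one_sqrtPoly_le k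
  obtain ⟨T, hT⟩ := cauchySeq_tendsto_of_complete (cauchySeq_of_dist_le_of_summable _ hd hsum)
  refine ⟨T, ?_, ?_, ?_⟩
  · refine tendsto_nhds_unique ?_ hT
    refine ((continuous_star.tendsto T).comp hT).congr fun k => husa k
  · exact le_of_tendsto hT.norm (Eventually.of_forall hnorm)
  · have h1 : Tendsto (fun k => u (k + 1)) atTop (𝓝 ((1 / 2 : ℝ) • (B + T ^ 2))) := by
      simp_rw [hsucc]
      exact (tendsto_const_nhds.add (hT.pow 2)).const_smul _
    have h2 := tendsto_nhds_unique h1 (hT.comp (tendsto_add_atTop_nat 1))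
    conv_rhs => rw [← h2, smul_smul]
    norm_num

/-- After rescaling, B = 1 - c⁻¹A†A is a contraction; if B + T² = 2T then (1 - T)² = 1 - B = c⁻¹A†A,
so √c (1 - T) is the root. It is positive because ‖T‖ ≤ 1. -/
theorem exists_isPosSqrt_adjoint_comp_self [CompleteSpace E] [CompleteSpace K]
    (A : E →L[ℝ] K) :
    ∃ S, IsPosSqrt S (A.adjoint ∘L A) := by
  -- Only c ≥ ‖A‖² is needed for the contraction bound; the added 1 keeps c positive when A = 0.
  set c : ℝ := ‖A‖ ^ 2 + 1 with hc
  have hc0 : 0 < c := by positivity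
  set G : E →L[ℝ] E := A.adjoint ∘L A with hG
  have hGsa : IsSelfAdjoint G := by
    rw [ContinuousLinearMap.isSelfAdjoint_iff']
    simp [hG, ContinuousLinearMap.adjoint_comp]
  have hin : ∀ x, inner ℝ (G x) x = ‖A x‖ ^ 2 := fun x => by
    rw [hG, ContinuousLinearMap.comp_apply, ContinuousLinearMap.adjoint_inner_left,
      real_inner_self_eq_norm_sq]
  have hB : ‖(1 : E →L[ℝ] E) - c⁻¹ • G‖ ≤ 1 := by
    refine ContinuousLinearMap.opNorm_le_bound _ zero_le_one fun x => ?_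
    rw [one_mul]
    refine le_of_sq_le_sq ?_ (norm_nonneg _)
    have h1 : ‖G x‖ ^ 2 ≤ c * ‖A x‖ ^ 2 := by
      have : ‖G x‖ ≤ ‖A‖ * ‖A x‖ := by
        rw [← ContinuousLinearMap.adjoint.norm_map A]
        exact A.adjoint.le_opNorm (A x)
      calc ‖G x‖ ^ 2 ≤ (‖A‖ * ‖A x‖) ^ 2 := by gcongr
        _ ≤ c * ‖A x‖ ^ 2 := by rw [mul_pow, hc]; nlinarith [sq_nonneg ‖A x‖]
    have h2 : ((1 : E →L[ℝ] E) - c⁻¹ • G) x = x - c⁻¹ • G x := rfl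
    rw [h2, norm_sub_sq_real, inner_smul_right, real_inner_comm, hin, norm_smul, mul_pow,
      Real.norm_of_nonneg (inv_nonneg.2 hc0.le)]
    have h3 : c⁻¹ ^ 2 * ‖G x‖ ^ 2 ≤ c⁻¹ * ‖A x‖ ^ 2 := by
      calc c⁻¹ ^ 2 * ‖G x‖ ^ 2 ≤ c⁻¹ ^ 2 * (c * ‖A x‖ ^ 2) := by gcongr
        _ = c⁻¹ * ‖A x‖ ^ 2 := by field_simp
    have h4 : 0 ≤ c⁻¹ * ‖A x‖ ^ 2 := by positivity
    linarith
  obtain ⟨T, hTsa, hT1, hT⟩ := exists_sq_add_eq_two_smul hB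
    ((IsSelfAdjoint.one _).sub ((IsSelfAdjoint.all _).smul hGsa))
  refine ⟨√c • (1 - T), ?_, ?_⟩
  · rw [ContinuousLinearMap.isPositive_iff]
    refine ⟨((IsSelfAdjoint.all _).smul ((IsSelfAdjoint.one _).sub hTsa)).isSymmetric, fun x => ?_⟩
    have h1 : (√c • (1 - T)) x = √c • (x - T x) := rfl
    rw [h1, inner_smul_left, inner_sub_left, real_inner_self_eq_norm_sq]
    refine mul_nonneg (Real.sqrt_nonneg _) (sub_nonneg.2 ?_)
    calc inner ℝ (T x) x ≤ ‖T x‖ * ‖x‖ := real_inner_le_norm _ _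
      _ ≤ (1 * ‖x‖) * ‖x‖ := by gcongr; exact T.le_of_opNorm_le hT1 x
      _ = ‖x‖ ^ 2 := by ring
  · have h1 : (√c • (1 - T)) ∘L (√c • (1 - T)) = c • ((1 - T) * (1 - T)) := by
      change (√c • (1 - T)) * (√c • (1 - T)) = _
      rw [smul_mul_smul_comm, Real.mul_self_sqrt hc0.le]
    have h2 : (1 - T) * (1 - T) = c⁻¹ • G := by
      have : (1 - T) * (1 - T) = 1 + T ^ 2 - (2 : ℝ) • T := by
        rw [two_smul]; noncomm_ring
      rw [this, ← hT]; abel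
    rw [h1, h2, smul_smul, mul_inv_cancel₀ hc0.ne', one_smul]

end SquareRoot

/-! ### Douglas factorization and Hilbert–Schmidt operators -/

section HilbertSchmidt

variable {E F K : Type*} [NormedAddCommGroup E] [InnerProductSpace ℝ E]
  [NormedAddCommGroup F] [InnerProductSpace ℝ F]
  [NormedAddCommGroup K] [InnerProductSpace ℝ K]

/-- Douglas' factorization: if `‖A x‖ ≤ ‖S x‖` then `A = U S` for a contraction `U`. -/
theorem exists_comp_eq_of_norm_le [CompleteSpace F] [CompleteSpace K]
    (A : E →L[ℝ] K) (S : E →L[ℝ] F) (h : ∀ x, ‖A x‖ ≤ ‖S x‖) :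
    ∃ U : F →L[ℝ] K, ‖U‖ ≤ 1 ∧ U ∘L S = A := by
  set V : Submodule ℝ F := (LinearMap.range (S : E →ₗ[ℝ] F)).topologicalClosure with hV
  have : CompleteSpace V := (Submodule.isClosed_topologicalClosure _).completeSpace_coe
  have hmem : ∀ x, S x ∈ V := fun x => Submodule.le_topologicalClosure _ ⟨x, rfl⟩
  set s : E →ₗ[ℝ] V := (S : E →ₗ[ℝ] F).codRestrict V hmem with hs
  have hdense : DenseRange s := by
    rw [DenseRange, dense_iff_closure_eq, Set.eq_univ_iff_forall]
    rintro ⟨y, hy⟩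
    rw [closure_subtype]
    have : (Subtype.val '' Set.range s : Set F) = Set.range S := by
      rw [← Set.range_comp]; rfl
    rw [this]
    exact hy
  have hn : ∀ x, ‖(A : E →ₗ[ℝ] K) x‖ ≤ 1 * ‖s x‖ := fun x => by
    rw [one_mul]; exact h x
  -- By the norm bound, A x depends only on S x, so A descends to the range of S and extends to its
  -- closure V; composing with the projection onto V sets it to zero on Vᗮ.
  set U₀ : V →L[ℝ] K := (A : E →ₗ[ℝ] K).extendOfNorm s
  refine ⟨U₀ ∘L V.orthogonalProjectionOnto, ?_, ?_⟩
  · refine ContinuousLinearMap.opNorm_le_bound _ zero_le_one fun y => ?_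
    refine (LinearMap.norm_extendOfNorm_apply_le hdense 1 hn _).trans ?_
    rw [one_mul, one_mul]
    exact V.norm_orthogonalProjectionOnto_apply_le y
  · ext x
    have h1 : V.orthogonalProjectionOnto (S x) = s x :=
      V.orthogonalProjectionOnto_mem_subspace_eq_self (s x)
    rw [ContinuousLinearMap.comp_apply, ContinuousLinearMap.comp_apply, h1]
    exact LinearMap.extendOfNorm_eq hdense ⟨1, hn⟩ x

theorem hasSum_sq_inner {ι : Type*} (b : HilbertBasis ι ℝ E) (x : E) :
    HasSum (fun i => (inner ℝ (b i) x) ^ 2) (‖x‖ ^ 2) := by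
  have h := b.hasSum_inner_mul_inner x x
  rw [real_inner_self_eq_norm_sq] at h
  refine h.congr_fun fun i => ?_
  rw [real_inner_comm, pow_two]

/-- An operator is Hilbert–Schmidt if its adjoint has finite Hilbert–Schmidt norm in some basis. -/
theorem isHilbertSchmidt_of_adjoint [CompleteSpace E] [CompleteSpace F]
    {ι : Type*} (c : HilbertBasis ι ℝ F) (A : E →L[ℝ] F)
    (h : Summable fun j => ‖A.adjoint (c j)‖ ^ 2) : IsHilbertSchmidt A := by
  obtain ⟨s, b, -⟩ := exists_hilbertBasis ℝ E
  refine ⟨s, b, ?_⟩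
  have hj : ∀ j, HasSum (fun i => (inner ℝ (A (b i)) (c j)) ^ 2) (‖A.adjoint (c j)‖ ^ 2) := by
    intro j
    simpa only [ContinuousLinearMap.adjoint_inner_right] using hasSum_sq_inner b (A.adjoint (c j))
  have hi : ∀ i, HasSum (fun j => (inner ℝ (A (b i)) (c j)) ^ 2) (‖A (b i)‖ ^ 2) := by
    intro i
    simpa only [real_inner_comm] using hasSum_sq_inner c (A (b i))
  -- The nonnegative double series of squared matrix entries may be summed in either order.
  have h1 : Summable fun p : ι × s => (inner ℝ (A (b p.2)) (c p.1)) ^ 2 := by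
    rw [summable_prod_of_nonneg fun _ => sq_nonneg _]
    exact ⟨fun j => (hj j).summable, by simpa only [(hj _).tsum_eq] using h⟩
  have h2 := (Equiv.prodComm s ι).summable_iff.2 h1
  have h3 := ((summable_prod_of_nonneg fun _ => sq_nonneg _).1 h2).2
  simpa only [Function.comp_apply, Equiv.prodComm_apply, Prod.fst_swap, Prod.snd_swap,
    (hi _).tsum_eq] using h3

/-- The value of `C A⁻¹` at `y` is `C x` for a preimage `x` of `y` under `A`. -/
theorem mulInv_apply (C : E →L[ℝ] F) (A : E →L[ℝ] E) (y : (mulInv C A).domain) :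
    ∃ x, A x = y ∧ mulInv C A y = C x := by
  obtain ⟨y, hy⟩ := y
  obtain ⟨x, hx⟩ : y ∈ LinearMap.range
      ((A : E →ₗ[ℝ] E).toPMap (LinearMap.ker (A : E →ₗ[ℝ] E))ᗮ).toFun := by
    rw [← LinearPMap.inverse_domain]; exact hy
  refine ⟨x, hx, ?_⟩
  exact congrArg C (LinearPMap.inverse_apply_eq (opInv_ker A) (y := ⟨y, hy⟩) (x := x) hx)

/-- Since ‖A x‖ = ‖S x‖, A = U S with ‖U‖ ≤ 1, so the operator is B†U on the range of S. Its adjoint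
U†B is dominated by B on the basis. -/
theorem isHilbertSchmidtPMap_mulInv_sqrt [CompleteSpace E] [CompleteSpace F] [CompleteSpace K]
    {ι : Type*} (c : HilbertBasis ι ℝ F)
    (A : E →L[ℝ] K) (B : F →L[ℝ] K) (hB : Summable fun j => ‖B (c j)‖ ^ 2) {S : E →L[ℝ] E}
    (hS : IsPosSqrt S (A.adjoint ∘L A)) :
    IsHilbertSchmidtPMap (mulInv (B.adjoint ∘L A) S) := by
  have hn : ∀ x, ‖A x‖ = ‖S x‖ := fun x => by
    have h1 : inner ℝ (S (S x)) x = inner ℝ (A.adjoint (A x)) x := by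
      change inner ℝ ((S ∘L S) x) x = inner ℝ ((A.adjoint ∘L A) x) x
      rw [hS.2]
    have h2 : inner ℝ (S (S x)) x = inner ℝ (S x) (S x) := hS.1.isSymmetric (S x) x
    rw [ContinuousLinearMap.adjoint_inner_left, h2, real_inner_self_eq_norm_sq, real_inner_self_eq_norm_sq] at h1
    exact ((sq_eq_sq₀ (norm_nonneg _) (norm_nonneg _)).1 h1).symm
  obtain ⟨U, hU, hUS⟩ := exists_comp_eq_of_norm_le A S fun x => (hn x).le
  refine ⟨B.adjoint ∘L U, isHilbertSchmidt_of_adjoint c _ ?_, fun y => ?_⟩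
  · refine Summable.of_nonneg_of_le (fun _ => sq_nonneg _) (fun j => ?_) hB
    rw [ContinuousLinearMap.adjoint_comp, ContinuousLinearMap.adjoint_adjoint]
    gcongr
    have : ‖U.adjoint‖ ≤ 1 := by rwa [ContinuousLinearMap.adjoint.norm_map]
    simpa using U.adjoint.le_of_opNorm_le this (B (c j))
  · obtain ⟨x, hx, hy⟩ := mulInv_apply _ _ y
    rw [hy, ← hx, ← hUS]
    rfl

end HilbertSchmidt

/-! ### Lévy's upward theorem in Banach spaces -/

section LevyUpward

variable {Ω E : Type*} {m0 : MeasurableSpace Ω} {P : Measure Ω} [IsFiniteMeasure P]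
  [NormedAddCommGroup E] [NormedSpace ℝ E] [CompleteSpace E]

/-- By linearity it suffices to treat an indicator times a fixed vector; the vector leaves the
conditional expectation and the scalar theorem applies. -/
theorem tendsto_ae_condExp_simpleFunc (ℱ : Filtration ℕ m0) (g : SimpleFunc Ω E) :
    ∀ᵐ ω ∂P, Tendsto (fun n => (P[g | ℱ n]) ω) atTop (𝓝 ((P[g | ⨆ n, ℱ n]) ω)) := by
  induction g using SimpleFunc.induction with
  | @const c s hs =>
    have hf : Integrable (s.indicator fun _ => (1 : ℝ)) P := (integrable_const _).indicator hs
    have hg : ⇑(SimpleFunc.piecewise s hs (SimpleFunc.const Ω c) (SimpleFunc.const Ω 0)) =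
        (s.indicator fun _ => (1 : ℝ)) • fun _ => c := by
      ext ω
      by_cases h : ω ∈ s <;> simp [h]
    have key : ∀ m : MeasurableSpace Ω, P[(s.indicator fun _ => (1 : ℝ)) • fun _ => c | m] =ᵐ[P]
        P[s.indicator fun _ => (1 : ℝ) | m] • fun _ => c := fun m =>
      condExp_smul_of_aestronglyMeasurable_right hf (hf.smul_const c)
        aestronglyMeasurable_const
    rw [hg]
    filter_upwards [tendsto_ae_condExp (ℱ := ℱ) (μ := P) (s.indicator fun _ => (1 : ℝ)),
      ae_all_iff.2 fun n => key (ℱ n), key (⨆ n, ℱ n)] with ω h1 h2 h3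
    simp_rw [h2, h3]
    exact h1.smul_const c
  | add _ hf hg =>
    rename_i f g _
    have hfi : Integrable f P := f.integrable_of_isFiniteMeasure
    have hgi : Integrable g P := g.integrable_of_isFiniteMeasure
    rw [SimpleFunc.coe_add]
    filter_upwards [hf, hg, ae_all_iff.2 fun n => condExp_add hfi hgi (ℱ n),
      condExp_add hfi hgi (⨆ n, ℱ n)] with ω h1 h2 h3 h4
    simp_rw [h3, h4]
    exact h1.add h2

/-- **Lévy's upward theorem** for integrable random variables with values in a Banach space. -/
theorem tendsto_ae_condExp_banach (ℱ : Filtration ℕ m0) {Y : Ω → E} (hY : Integrable Y P) :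
    ∀ᵐ ω ∂P, Tendsto (fun n => (P[Y | ℱ n]) ω) atTop (𝓝 ((P[Y | ⨆ n, ℱ n]) ω)) := by
  have happrox : ∀ k : ℕ, ∃ g : SimpleFunc Ω E,
      eLpNorm (Y - ⇑g) 1 P < ((k : ENNReal) + 1)⁻¹ := fun k => by
    obtain ⟨g, hg, -⟩ := (memLp_one_iff_integrable.2 hY).exists_simpleFunc_eLpNorm_sub_lt
      ENNReal.one_ne_top (ε := ((k : ENNReal) + 1)⁻¹) (by simp)
    exact ⟨g, hg⟩
  choose g hg using happrox
  have hgi : ∀ k, Integrable (g k) P := fun k => (g k).integrable_of_isFiniteMeasure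
  -- `d k` bounds the approximation error at the limit σ-algebra, and by the scalar theorem it is
  -- also the limit of the bounds at level n. It tends to 0 in L¹, hence almost surely along a
  -- subsequence.
  set d : ℕ → Ω → ℝ := fun k => P[fun ω => ‖(Y - ⇑(g k)) ω‖ | ⨆ n, ℱ n] with hd
  have hd0 : Tendsto (fun k => eLpNorm (d k - 0) 1 P) atTop (𝓝 0) := by
    have h0 : Tendsto (fun k : ℕ => ((k : ENNReal) + 1)⁻¹) atTop (𝓝 0) := by
      have := (tendsto_add_atTop_iff_nat 1).2 ENNReal.tendsto_inv_nat_nhds_zero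
      simpa using this
    refine tendsto_of_tendsto_of_tendsto_of_le_of_le tendsto_const_nhds h0
      (fun _ => zero_le) fun k => ?_
    rw [sub_zero]
    refine (eLpNorm_condExp_le_eLpNorm _ le_rfl).trans ?_
    rw [eLpNorm_norm]
    exact (hg k).le
  obtain ⟨ns, -, hns⟩ := (tendstoInMeasure_of_tendsto_eLpNorm one_ne_zero
    (fun k => integrable_condExp.aestronglyMeasurable) aestronglyMeasurable_zero
    hd0).exists_seq_tendsto_ae
  filter_upwards [hns, ae_all_iff.2 fun k => tendsto_ae_condExp_simpleFunc (P := P) ℱ (g k),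
    ae_all_iff.2 fun k => tendsto_ae_condExp (ℱ := ℱ) (μ := P) fun ω => ‖(Y - ⇑(g k)) ω‖,
    ae_all_iff.2 fun k => ae_all_iff.2 fun n => norm_condExp_le (m := ℱ n) (μ := P) (Y - ⇑(g k)),
    ae_all_iff.2 fun k => norm_condExp_le (m := ⨆ n, ℱ n) (μ := P) (Y - ⇑(g k)),
    ae_all_iff.2 fun k => ae_all_iff.2 fun n => condExp_sub hY (hgi k) (ℱ n),
    ae_all_iff.2 fun k => condExp_sub hY (hgi k) (⨆ n, ℱ n)] with ω h1 h2 h3 h4 h5 h6 h7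
  rw [Metric.tendsto_atTop']
  intro ε hε
  have hε4 : 0 < ε / 4 := by positivity
  obtain ⟨j, hj⟩ := (h1.eventually (gt_mem_nhds hε4)).exists
  obtain ⟨N, hN⟩ := eventually_atTop.1 (((h3 (ns j)).eventually (gt_mem_nhds hj)).and
    ((Metric.tendsto_nhds.1 (h2 (ns j))) (ε / 4) hε4))
  refine ⟨N, fun n hn => ?_⟩
  obtain ⟨hn1, hn2⟩ := hN n hn.le
  have a1 : ‖(P[Y | ℱ n]) ω - (P[g (ns j) | ℱ n]) ω‖ < ε / 4 := by
    have := (h4 (ns j) n).trans_lt hn1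
    rwa [h6 (ns j) n] at this
  have a2 : ‖(P[Y | ⨆ n, ℱ n]) ω - (P[g (ns j) | ⨆ n, ℱ n]) ω‖ < ε / 4 := by
    have := (h5 (ns j)).trans_lt hj
    rwa [h7 (ns j)] at this
  rw [← dist_eq_norm] at a1 a2
  calc _ ≤ _ := dist_triangle4_right _ _ ((P[g (ns j) | ℱ n]) ω) ((P[g (ns j) | ⨆ n, ℱ n]) ω)
    _ < ε := by linarith

end LevyUpward

/-! ### Covariance operators factored through L²(P) -/

section Observables

variable {Ω E F : Type*} [MeasurableSpace Ω] {P : Measure Ω}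
  [NormedAddCommGroup E] [InnerProductSpace ℝ E]
  [NormedAddCommGroup F] [InnerProductSpace ℝ F]

/-- The operator `h ↦ ⟪Z, h⟫` from `E` to `L²(P)`. -/
def obs (Z : Ω → E) (hZ : MemLp Z 2 P) : E →L[ℝ] Lp ℝ 2 P :=
  LinearMap.mkContinuous
    { toFun := fun h => (innerSL ℝ h).compLp (hZ.toLp Z)
      map_add' := fun h k => by rw [map_add, ContinuousLinearMap.add_compLp]
      map_smul' := fun c h => by
        rw [map_smul, ContinuousLinearMap.smul_compLp, RingHom.id_apply] }
    ‖hZ.toLp Z‖ fun h => by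
      have := (innerSL ℝ h).norm_compLp_le (hZ.toLp Z)
      rwa [innerSL_apply_norm, mul_comm] at this

theorem coeFn_obs {Z : Ω → E} (hZ : MemLp Z 2 P) (h : E) :
    obs Z hZ h =ᵐ[P] fun ω => inner ℝ (Z ω) h := by
  filter_upwards [(innerSL ℝ h).coeFn_compLp (hZ.toLp Z), hZ.coeFn_toLp] with ω h1 h2
  change (innerSL ℝ h).compLp (hZ.toLp Z) ω = _
  rw [h1, h2, innerSL_apply_apply, real_inner_comm]

theorem inner_obs {Z : Ω → E} {V : Ω → F} (hZ : MemLp Z 2 P) (hV : MemLp V 2 P) (h : E) (k : F) :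
    inner ℝ (obs Z hZ h) (obs V hV k) = ∫ ω, inner ℝ (Z ω) h * inner ℝ (V ω) k ∂P := by
  rw [L2.inner_def]
  refine integral_congr_ae ?_
  filter_upwards [coeFn_obs hZ h, coeFn_obs hV k] with ω h1 h2
  rw [h1, h2]
  exact mul_comm _ _

theorem crossCov_eq_adjoint_comp [CompleteSpace E] [CompleteSpace F] [IsProbabilityMeasure P] {X : Ω → E} {Y : Ω → F}
    (hX : MemLp X 2 P) (hY : MemLp Y 2 P)
    (hX' : MemLp (fun ω => X ω - ∫ ω', X ω' ∂P) 2 P)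
    (hY' : MemLp (fun ω => Y ω - ∫ ω', Y ω' ∂P) 2 P) :
    crossCov P X Y = (obs _ hY').adjoint ∘L obs _ hX' := by
  ext h
  refine ext_inner_right ℝ fun k => ?_
  rw [inner_crossCov P X Y hX hY, ContinuousLinearMap.comp_apply,
    ContinuousLinearMap.adjoint_inner_left, inner_obs]

/-- Bessel's inequality inside the expectation bounds every partial sum by E‖V‖². -/
theorem summable_norm_obs_sq {ι : Type*} {V : Ω → F} (hV : MemLp V 2 P)
    (c : HilbertBasis ι ℝ F) : Summable fun j => ‖obs V hV (c j)‖ ^ 2 := by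
  refine summable_of_sum_le (c := ∫ ω, ‖V ω‖ ^ 2 ∂P) (fun _ => sq_nonneg _) fun s => ?_
  have hi : ∀ j ∈ s, Integrable (fun ω => inner ℝ (V ω) (c j) * inner ℝ (V ω) (c j)) P :=
    fun j _ => (hV.inner_const (c j)).integrable_mul (hV.inner_const (c j))
  simp_rw [← real_inner_self_eq_norm_sq, inner_obs]
  rw [← integral_finsetSum _ hi]
  refine integral_mono (integrable_finsetSum _ hi) ?_ fun ω => ?_
  · simpa only [real_inner_self_eq_norm_sq] using hV.integrable_norm_pow two_ne_zero
  · have := c.orthonormal.sum_inner_products_le (V ω) (s := s)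
    rw [real_inner_self_eq_norm_sq]
    refine le_trans (le_of_eq ?_) this
    refine Finset.sum_congr rfl fun j _ => ?_
    rw [Real.norm_eq_abs, sq_abs, pow_two, real_inner_comm]

end Observables

/-! ### Finite-dimensional regression operators -/

section Regression

variable {E K : Type*} [NormedAddCommGroup E] [InnerProductSpace ℝ E] [CompleteSpace E]
  [NormedAddCommGroup K] [InnerProductSpace ℝ K] [CompleteSpace K]

/-- For a finite-dimensional `W` there is a finite-rank `R` on `W` such that `A R A†` is the
orthogonal projection onto `A W`, so that `R` inverts the compression of `A† A` to `W`. -/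
theorem exists_adjoint_conj_eq_starProjection (A : E →L[ℝ] K) (W : Submodule ℝ E)
    [FiniteDimensional ℝ W] :
    ∃ R : E →L[ℝ] E, R.adjoint = R ∧ R ∘L W.starProjection = R ∧
      A ∘L R ∘L A.adjoint = (W.map (A : E →ₗ[ℝ] K)).starProjection := by
  set b := stdOrthonormalBasis ℝ (W.map (A : E →ₗ[ℝ] K))
  have hb : ∀ j, ∃ g ∈ W, A g = b j := fun j => (b j).2
  choose g hgW hg using hb
  -- The `b j` form an orthonormal basis of A W and `g j ∈ W` are preimages, so A R A† φ = ∑ ⟪b_j,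
  -- φ⟫ b_j.
  refine ⟨∑ j, InnerProductSpace.rankOne ℝ (g j) (g j), ?_, ?_, ?_⟩
  · simp
  · ext x
    simp only [ContinuousLinearMap.comp_apply, _root_.sum_apply,
      InnerProductSpace.rankOne_apply]
    refine Finset.sum_congr rfl fun j _ => ?_
    rw [← Submodule.inner_starProjection_left_eq_right,
      Submodule.starProjection_eq_self_iff.2 (hgW j)]
  · ext φ
    rw [b.starProjection_eq_sum_rankOne]
    simp only [ContinuousLinearMap.comp_apply, _root_.sum_apply,
      InnerProductSpace.rankOne_apply, map_sum, map_smul, hg,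
      ContinuousLinearMap.adjoint_inner_right]

end Regression

/-! ### Independence of residuals and finite-dimensional conditioning -/

section GaussianRegression

variable {Ω E F : Type*} [MeasurableSpace Ω] {P : Measure Ω} [IsProbabilityMeasure P]
  [NormedAddCommGroup E] [InnerProductSpace ℝ E] [CompleteSpace E] [SecondCountableTopology E]
  [MeasurableSpace E] [BorelSpace E]
  [NormedAddCommGroup F] [InnerProductSpace ℝ F] [CompleteSpace F] [SecondCountableTopology F]
  [MeasurableSpace F] [BorelSpace F]

/-- A centered Gaussian random variable is symmetric. -/
theorem map_neg_eq_map {Z : Ω → E} (hZ : HasGaussianLaw Z P) (hZ0 : ∫ ω, Z ω ∂P = 0) :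
    P.map (fun ω => -Z ω) = P.map Z := by
  have := hZ.isGaussian_map
  have := hZ.fun_neg.isGaussian_map
  refine Measure.ext_of_charFun (funext fun t => ?_)
  have h0 : ∫ ω, inner ℝ t (Z ω) ∂P = 0 := by
    rw [integral_inner hZ.integrable, hZ0, inner_zero_right]
  rw [hZ.charFun_map_eq, hZ.fun_neg.charFun_map_eq]
  simp only [inner_neg_right]
  rw [integral_neg, h0, neg_zero, variance_fun_neg]

/-- The residual of the Gaussian regression of `V` on the projection of `Z` to `W` is
independent of that projection. -/
theorem indepFun_residual {Z : Ω → E} {V : Ω → F} (hZV : HasGaussianLaw (fun ω => (Z ω, V ω)) P)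
    (hZ : MemLp Z 2 P) (hV : MemLp V 2 P) (hZ0 : ∫ ω, Z ω ∂P = 0)
    (W : Submodule ℝ E) [FiniteDimensional ℝ W] {R : E →L[ℝ] E} (hR : R.adjoint = R)
    (hAR : obs Z hZ ∘L R ∘L (obs Z hZ).adjoint = (W.map (obs Z hZ : E →ₗ[ℝ] _)).starProjection) :
    IndepFun (fun ω => V ω - (obs V hV).adjoint (obs Z hZ (R (Z ω))))
      (fun ω => W.starProjection (Z ω)) P := by
  set A := obs Z hZ with hA
  set B := obs V hV with hB
  have hgauss : HasGaussianLaw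
      (fun ω => (V ω - B.adjoint (A (R (Z ω))), W.starProjection (Z ω))) P :=
    hZV.map_fun (((ContinuousLinearMap.snd ℝ E F) -
      (B.adjoint ∘L A ∘L R) ∘L (ContinuousLinearMap.fst ℝ E F)).prod
        (W.starProjection ∘L ContinuousLinearMap.fst ℝ E F))
  refine hgauss.indepFun_of_covariance_inner fun x y => ?_
  have h1 : ∀ ω, inner ℝ x (V ω - B.adjoint (A (R (Z ω)))) =
      inner ℝ (V ω) x - inner ℝ (Z ω) (R (A.adjoint (B x))) := fun ω => by
    rw [inner_sub_right, real_inner_comm, ContinuousLinearMap.adjoint_inner_right,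
      ← ContinuousLinearMap.adjoint_inner_left, ← ContinuousLinearMap.adjoint_inner_left, hR,
      real_inner_comm (Z ω)]
  have h2 : ∀ ω, inner ℝ y (W.starProjection (Z ω)) = inner ℝ (Z ω) (W.starProjection y) :=
    fun ω => by rw [← Submodule.inner_starProjection_left_eq_right, real_inner_comm]
  simp_rw [h1, h2]
  have m1 := hV.inner_const (𝕜 := ℝ) x
  have m2 := hZ.inner_const (𝕜 := ℝ) (R (A.adjoint (B x)))
  have m3 := hZ.inner_const (𝕜 := ℝ) (W.starProjection y)
  have h0 : ∫ ω, inner ℝ (Z ω) (W.starProjection y) ∂P = 0 := by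
    simp_rw [real_inner_comm (W.starProjection y)]
    rw [integral_inner (hZ.integrable one_le_two), hZ0, inner_zero_right]
  refine (covariance_eq_sub (m1.sub m2) m3).trans ?_
  rw [h0, mul_zero, sub_zero]
  simp only [Pi.mul_apply, Pi.sub_apply, sub_mul]
  refine (integral_sub (m1.integrable_mul m3) (m2.integrable_mul m3)).trans ?_
  simp only [Pi.mul_apply]
  rw [← inner_obs hV hZ, ← inner_obs hZ hZ, ← hA, ← hB, ← inner_sub_left]
  -- The covariance is now ⟪B x - A R A† B x, A (P_W y)⟫: a vector orthogonal to A W against an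
  -- element of A W.
  have h3 : A (R (A.adjoint (B x))) = (W.map (A : E →ₗ[ℝ] _)).starProjection (B x) := by
    rw [← hAR]; rfl
  rw [h3]
  exact Submodule.starProjection_inner_eq_zero (B x) _
    (Submodule.mem_map_of_mem (W.starProjection_apply_mem y))

/-- If `V - T` is centered and independent of `m` and `T` is `m`-measurable, then `E[V | m] = T`. -/
theorem condExp_eq_of_indep_sub {Ω F : Type*} {m m0 : MeasurableSpace Ω} {P : Measure Ω}
    [IsProbabilityMeasure P] [NormedAddCommGroup F] [NormedSpace ℝ F] [CompleteSpace F]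
    [SecondCountableTopology F] [MeasurableSpace F] [BorelSpace F] (hle : m ≤ m0) {V T : Ω → F}
    (hV : Integrable V P) (hT : Integrable T P) (hTm : StronglyMeasurable[m] T)
    (hm : Measurable (V - T)) (hind : Indep (MeasurableSpace.comap (V - T) inferInstance) m P)
    (h0 : ∫ ω, (V - T) ω ∂P = 0) : P[V | m] =ᵐ[P] T := by
  have hres := condExp_indep_eq hm.comap_le hle (comap_measurable _).stronglyMeasurable hind
  rw [h0] at hres
  filter_upwards [hres, condExp_sub hV hT m] with ω h1 h2
  rw [h2, Pi.sub_apply, condExp_of_stronglyMeasurable hle hTm hT] at h1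
  exact sub_eq_zero.1 h1

/-- The conditional expectation given finitely many coordinates is the regression. -/
theorem condExp_comap_starProjection {Z : Ω → E} {V : Ω → F}
    (hZV : HasGaussianLaw (fun ω => (Z ω, V ω)) P) (hZm : Measurable Z) (hVm : Measurable V)
    (hZ : MemLp Z 2 P) (hV : MemLp V 2 P) (hZ0 : ∫ ω, Z ω ∂P = 0) (hV0 : ∫ ω, V ω ∂P = 0)
    (W : Submodule ℝ E) [FiniteDimensional ℝ W] {R : E →L[ℝ] E} (hR : R.adjoint = R)
    (hRW : R ∘L W.starProjection = R)
    (hAR : obs Z hZ ∘L R ∘L (obs Z hZ).adjoint = (W.map (obs Z hZ : E →ₗ[ℝ] _)).starProjection) :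
    P[V | MeasurableSpace.comap (fun ω => W.starProjection (Z ω)) inferInstance] =ᵐ[P]
      fun ω => (obs V hV).adjoint (obs Z hZ (R (Z ω))) := by
  set T : E →L[ℝ] F := (obs V hV).adjoint ∘L obs Z hZ ∘L R with hT
  have hpm : Measurable fun ω => W.starProjection (Z ω) :=
    W.starProjection.continuous.measurable.comp hZm
  have hZi : Integrable Z P := hZ.integrable one_le_two
  have hVi : Integrable V P := hV.integrable one_le_two
  have hTi : Integrable (fun ω => T (Z ω)) P := T.integrable_comp hZi
  have hTW : (fun ω => T (Z ω)) = fun ω => T (W.starProjection (Z ω)) := by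
    funext ω
    have h1 : R (W.starProjection (Z ω)) = R (Z ω) :=
      congrArg (fun S : E →L[ℝ] E => S (Z ω)) hRW
    simp only [hT, ContinuousLinearMap.comp_apply, h1]
  refine condExp_eq_of_indep_sub (T := fun ω => T (Z ω)) hpm.comap_le hVi hTi ?_
    (hVm.sub (T.continuous.measurable.comp hZm)) (indepFun_residual hZV hZ hV hZ0 W hR hAR) ?_
  · rw [hTW]
    exact (T.continuous.measurable.comp (comap_measurable _)).stronglyMeasurable
  · rw [integral_sub' hVi hTi, hV0, T.integral_comp_comm hZi, hZ0, map_zero, sub_zero]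

end GaussianRegression

/-! ### Measurable linear transformations as pointwise limits -/

section PartialMaps

variable {E F : Type*} [NormedAddCommGroup E] [InnerProductSpace ℝ E]
  [NormedAddCommGroup F] [InnerProductSpace ℝ F]

/-- The pointwise limit of a sequence of bounded operators, on the subspace where it exists. -/
def limPMap (T : ℕ → E →L[ℝ] F) : E →ₗ.[ℝ] F where
  domain :=
    { carrier := {x | ∃ y, Tendsto (fun m => T m x) atTop (𝓝 y)}
      zero_mem' := ⟨0, by simp⟩
      add_mem' := by
        rintro a b ⟨y, hy⟩ ⟨z, hz⟩
        exact ⟨y + z, by simpa only [map_add] using hy.add hz⟩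
      smul_mem' := by
        rintro c a ⟨y, hy⟩
        exact ⟨c • y, by simpa only [map_smul] using hy.const_smul c⟩ }
  toFun :=
    { toFun := fun x => x.2.choose
      map_add' := fun a b => tendsto_nhds_unique (a + b).2.choose_spec (by
        simpa only [Submodule.coe_add, map_add] using a.2.choose_spec.add b.2.choose_spec)
      map_smul' := fun c a => tendsto_nhds_unique (c • a).2.choose_spec (by
        simpa only [Submodule.coe_smul, map_smul, RingHom.id_apply] using
          a.2.choose_spec.const_smul c) }

theorem tendsto_limPMap (T : ℕ → E →L[ℝ] F) (x : (limPMap T).domain) :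
    Tendsto (fun m => T m x) atTop (𝓝 (limPMap T x)) := x.2.choose_spec

variable [MeasurableSpace E] [MeasurableSpace F] [BorelSpace F]

theorem isMeasurableLinear_limPMap [BorelSpace E] [CompleteSpace F] [SecondCountableTopology F]
    (T : ℕ → E →L[ℝ] F) {ν : Measure E}
    (h : ∀ᵐ x ∂ν, ∃ y, Tendsto (fun m => T m x) atTop (𝓝 y)) :
    IsMeasurableLinear ν (limPMap T) :=
  ⟨measurableSet_exists_tendsto fun m => (T m).continuous.measurable, h,
    measurable_of_tendsto_metrizable
      (fun m => (T m).continuous.measurable.comp measurable_subtype_coe)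
      (tendsto_pi_nhds.2 (tendsto_limPMap T))⟩

theorem IsMeasurableLinear.sub [SecondCountableTopology F] {ν : Measure E} {L₁ L₂ : E →ₗ.[ℝ] F}
    (h₁ : IsMeasurableLinear ν L₁) (h₂ : IsMeasurableLinear ν L₂) :
    IsMeasurableLinear ν (L₁ - L₂) := by
  refine ⟨h₁.1.inter h₂.1, ?_, ?_⟩
  · have : (((L₁ - L₂).domain : Submodule ℝ E) : Set E)ᶜ =
        (L₁.domain : Set E)ᶜ ∪ (L₂.domain : Set E)ᶜ := Set.compl_inter _ _
    rw [this]
    exact measure_union_null h₁.2.1 h₂.2.1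
  · have m1 : Measurable fun x : (L₁ - L₂).domain => (⟨x, x.2.1⟩ : L₁.domain) :=
      measurable_subtype_coe.subtype_mk
    have m2 : Measurable fun x : (L₁ - L₂).domain => (⟨x, x.2.2⟩ : L₂.domain) :=
      measurable_subtype_coe.subtype_mk
    exact (h₁.2.2.comp m1).sub (h₂.2.2.comp m2)

end PartialMaps

/-- If `⋃ W m` is dense, the projections of `A h` to `A (W m)` converge to `A h`. -/
theorem tendsto_starProjection_map {E K : Type*} [NormedAddCommGroup E] [InnerProductSpace ℝ E]
    [NormedAddCommGroup K] [InnerProductSpace ℝ K] [CompleteSpace K] (A : E →L[ℝ] K)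
    {W : ℕ → Submodule ℝ E} [∀ m, FiniteDimensional ℝ (W m)] (hW : Monotone W)
    (hWd : ⊤ ≤ (⨆ m, W m).topologicalClosure) (h : E) :
    Tendsto (fun m => ((W m).map (A : E →ₗ[ℝ] K)).starProjection (A h)) atTop (𝓝 (A h)) := by
  set U : ℕ → Submodule ℝ K := fun m => (W m).map (A : E →ₗ[ℝ] K)
  have hU : Monotone U := fun m k hmk => Submodule.map_mono (hW hmk)
  have hmem : A h ∈ (⨆ m, U m).topologicalClosure := by
    have h1 : h ∈ closure ((⨆ m, W m : Submodule ℝ E) : Set E) := hWd trivial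
    refine map_mem_closure A.continuous h1 fun x hx => ?_
    change A x ∈ (⨆ m, U m)
    rw [← Submodule.map_iSup]
    exact ⟨x, hx, rfl⟩
  have : CompleteSpace (⨆ m, U m).topologicalClosure :=
    (Submodule.isClosed_topologicalClosure _).completeSpace_coe
  have h2 := Submodule.starProjection_tendsto_closure_iSup U hU (A h)
  rwa [Submodule.starProjection_eq_self_iff.2 hmem] at h2

/-! ### The limiting regression and its almost sure uniqueness -/

section Main

variable {Ω E F : Type*} [MeasurableSpace Ω] {P : Measure Ω} [IsProbabilityMeasure P]
  [NormedAddCommGroup E] [InnerProductSpace ℝ E] [MeasurableSpace E] [BorelSpace E]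
  [NormedAddCommGroup F] [InnerProductSpace ℝ F] [SecondCountableTopology F]
  [MeasurableSpace F] [BorelSpace F]

/-- The filtration generated by the projections of `Z` to an increasing sequence of subspaces. -/
def projFiltration {Z : Ω → E} (hZm : Measurable Z) {W : ℕ → Submodule ℝ E}
    [∀ m, FiniteDimensional ℝ (W m)] (hW : Monotone W) : Filtration ℕ ‹MeasurableSpace Ω› where
  seq m := MeasurableSpace.comap (fun ω => (W m).starProjection (Z ω)) inferInstance
  mono' := by
    intro m k hmk
    have h : (fun ω => (W m).starProjection (Z ω)) =
        (W m).starProjection ∘ fun ω => (W k).starProjection (Z ω) := by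
      funext ω
      have := Submodule.starProjection_comp_starProjection_of_le (hW hmk)
      exact (congrArg (fun S : E →L[ℝ] E => S (Z ω)) this).symm
    beta_reduce
    rw [h, ← MeasurableSpace.comap_comp]
    exact MeasurableSpace.comap_mono (W m).starProjection.continuous.measurable.comap_le
  le' m := ((W m).starProjection.continuous.measurable.comp hZm).comap_le

/-- Density makes Z the pointwise limit of its projections, so Z is measurable for the σ-algebra
they generate. -/
theorem iSup_projFiltration {Z : Ω → E} (hZm : Measurable Z) {W : ℕ → Submodule ℝ E}
    [∀ m, FiniteDimensional ℝ (W m)] (hW : Monotone W)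
    (hWd : ⊤ ≤ (⨆ m, W m).topologicalClosure) :
    ⨆ m, projFiltration hZm hW m = MeasurableSpace.comap Z inferInstance := by
  refine le_antisymm (iSup_le fun m => ?_) ?_
  · change MeasurableSpace.comap ((W m).starProjection ∘ Z) _ ≤ _
    rw [← MeasurableSpace.comap_comp]
    exact MeasurableSpace.comap_mono (W m).starProjection.continuous.measurable.comap_le
  · refine Measurable.comap_le (@measurable_of_tendsto_metrizable Ω E
      (⨆ m, projFiltration hZm hW m) _ _ _ _ (fun m ω => (W m).starProjection (Z ω)) _ (fun m => ?_)
      (tendsto_pi_nhds.2 fun ω => Submodule.starProjection_tendsto_self W hW (Z ω) hWd))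
    exact Measurable.mono (comap_measurable fun ω => (W m).starProjection (Z ω))
      (le_iSup (fun m => projFiltration hZm hW m) m) le_rfl

variable [CompleteSpace E] [SecondCountableTopology E]

/-- A measurable linear transformation that vanishes on the range of the covariance operator
of a centered Gaussian variable vanishes almost surely. -/
theorem ae_eq_zero_of_isMeasurableLinear {Z : Ω → E} (hZm : Measurable Z)
    (hZg : HasGaussianLaw Z P) (hZ : MemLp Z 2 P) (hZ0 : ∫ ω, Z ω ∂P = 0)
    {W : ℕ → Submodule ℝ E} [∀ m, FiniteDimensional ℝ (W m)] (hW : Monotone W)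
    (hWd : ⊤ ≤ (⨆ m, W m).topologicalClosure) {M : E →ₗ.[ℝ] F}
    (hM : IsMeasurableLinear (P.map Z) M)
    (hM0 : ∀ h, ∃ hd : (obs Z hZ).adjoint (obs Z hZ h) ∈ M.domain, M ⟨_, hd⟩ = 0) :
    ∀ᵐ ω ∂P, ∀ hd : Z ω ∈ M.domain, M ⟨Z ω, hd⟩ = 0 := by
  classical
  -- Extension by zero loses linearity but stays odd and invariant under translation by the range of
  -- A†A, which is all that is used.
  set N : E → F := fun x => if hx : x ∈ M.domain then M ⟨x, hx⟩ else 0 with hN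
  have hNm : Measurable N :=
    Measurable.dite (s := {x | x ∈ M.domain}) hM.2.2 measurable_const hM.1
  have hNneg : ∀ x, N (-x) = -N x := fun x => by
    by_cases hx : x ∈ M.domain
    · have hx' : -x ∈ M.domain := M.domain.neg_mem hx
      simp only [hN, hx, hx', dif_pos]
      exact M.map_neg ⟨x, hx⟩
    · have hx' : -x ∉ M.domain := fun h => hx (by simpa using M.domain.neg_mem h)
      simp only [hN, hx, hx', dif_neg, not_false_eq_true, neg_zero]
  have hNsub : ∀ x h, N (x - (obs Z hZ).adjoint (obs Z hZ h)) = N x := fun x h => by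
    obtain ⟨hd, h0⟩ := hM0 h
    by_cases hx : x ∈ M.domain
    · have hx' := M.domain.sub_mem hx hd
      simp only [hN, hx, hx', dif_pos]
      have := M.map_sub ⟨x, hx⟩ ⟨_, hd⟩
      rw [h0, sub_zero] at this
      exact this
    · have hx' : x - (obs Z hZ).adjoint (obs Z hZ h) ∉ M.domain := fun h' =>
        hx (by simpa using M.domain.add_mem h' hd)
      simp only [hN, hx, hx', dif_neg, not_false_eq_true]
  have hNZ : Measurable fun ω => N (Z ω) := hNm.comp hZm
  -- The residual Z - A†A R_m Z is independent of the m-th projection, and N takes the same value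
  -- there as at Z. Letting m grow, N Z is independent of σ(Z), which contains σ(N Z).
  have hself : Indep (MeasurableSpace.comap (fun ω => N (Z ω)) inferInstance)
      (MeasurableSpace.comap (fun ω => N (Z ω)) inferInstance) P := by
    have h1 : ∀ m, Indep (projFiltration hZm hW m)
        (MeasurableSpace.comap (fun ω => N (Z ω)) inferInstance) P := fun m => by
      obtain ⟨R, hR, -, hAR⟩ := exists_adjoint_conj_eq_starProjection (obs Z hZ) (W m)
      have hZZ : HasGaussianLaw (fun ω => (Z ω, Z ω)) P :=
        hZg.map_fun ((ContinuousLinearMap.id ℝ E).prod (ContinuousLinearMap.id ℝ E))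
      have h2 := (indepFun_residual hZZ hZ hZ hZ0 (W m) hR hAR).comp hNm measurable_id
      have h3 : N ∘ (fun ω => Z ω - (obs Z hZ).adjoint (obs Z hZ (R (Z ω)))) =
          fun ω => N (Z ω) := funext fun ω => hNsub _ _
      rw [h3] at h2
      exact h2.symm
    have h2 := indep_iSup_of_monotone h1 (projFiltration hZm hW).le hNZ.comap_le
      (fun _ _ hmk => (projFiltration hZm hW).mono hmk)
    rw [iSup_projFiltration hZm hW hWd] at h2
    refine indep_of_indep_of_le_left h2 ?_
    change MeasurableSpace.comap (N ∘ Z) _ ≤ _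
    rw [← MeasurableSpace.comap_comp]
    exact MeasurableSpace.comap_mono hNm.comap_le
  -- The event has probability 0 or 1, and its mirror image under Z ↦ -Z is disjoint and equally
  -- likely, which excludes 1.
  have hpos : ∀ k : F, P {ω | 0 < inner ℝ (N (Z ω)) k} = 0 := fun k => by
    have hS : MeasurableSet {y : F | 0 < inner ℝ y k} :=
      (isOpen_lt continuous_const (by fun_prop)).measurableSet
    have hS' : MeasurableSet {y : F | inner ℝ y k < 0} :=
      (isOpen_lt (by fun_prop) continuous_const).measurableSet
    have hsymm : P {ω | inner ℝ (N (Z ω)) k < 0} = P {ω | 0 < inner ℝ (N (Z ω)) k} := by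
      have h1 : P.map (fun ω => -Z ω) (N ⁻¹' {y | 0 < inner ℝ y k}) =
          P.map Z (N ⁻¹' {y | 0 < inner ℝ y k}) := by rw [map_neg_eq_map hZg hZ0]
      rw [Measure.map_apply hZm (hNm hS), Measure.map_apply hZm.fun_neg (hNm hS)] at h1
      rw [show {ω | 0 < inner ℝ (N (Z ω)) k} = Z ⁻¹' (N ⁻¹' {y | 0 < inner ℝ y k}) from rfl,
        ← h1]
      congr 1
      ext ω
      simp [hNneg, inner_neg_left]
    rcases measure_eq_zero_or_one_of_indepSet_self
      (hself.indepSet_of_measurableSet ⟨_, hS, rfl⟩ ⟨_, hS, rfl⟩) with h0 | h1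
    · exact h0
    · have h1' : P {ω | 0 < inner ℝ (N (Z ω)) k} = 1 := h1
      have hdisj : Disjoint {ω | 0 < inner ℝ (N (Z ω)) k} {ω | inner ℝ (N (Z ω)) k < 0} :=
        Set.disjoint_left.2 fun ω (h : 0 < inner ℝ (N (Z ω)) k) h' => lt_asymm h h'
      have h2 := measure_union (μ := P) hdisj (hNZ hS')
      rw [hsymm, h1'] at h2
      have h3 := prob_le_one (μ := P)
        (s := {ω | 0 < inner ℝ (N (Z ω)) k} ∪ {ω | inner ℝ (N (Z ω)) k < 0})
      rw [h2, one_add_one_eq_two] at h3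
      exact absurd h3 (by norm_num)
  have hzero : ∀ᵐ ω ∂P, ∀ j : ℕ, ¬ 0 < inner ℝ (N (Z ω)) (TopologicalSpace.denseSeq F j) :=
    ae_all_iff.2 fun j => by simpa [ae_iff] using hpos (TopologicalSpace.denseSeq F j)
  filter_upwards [hzero] with ω hω hd
  -- The inequality on a countable dense set extends by closedness to the test vector N (Z ω)
  -- itself.
  have h1 : inner ℝ (N (Z ω)) (N (Z ω)) ≤ 0 := by
    have hcl : IsClosed {y : F | inner ℝ (N (Z ω)) y ≤ 0} :=
      isClosed_le (by fun_prop) continuous_const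
    have hsub : Set.range (TopologicalSpace.denseSeq F) ⊆ {y : F | inner ℝ (N (Z ω)) y ≤ 0} := by
      rintro _ ⟨j, rfl⟩
      exact not_lt.1 (hω j)
    exact hcl.closure_subset_iff.2 hsub (TopologicalSpace.denseRange_denseSeq F _)
  have h2 : N (Z ω) = 0 := inner_self_eq_zero.1 (le_antisymm h1 real_inner_self_nonneg)
  simpa [hN, hd] using h2

/-- For centered jointly Gaussian `Z`, `V`: there are finite-rank operators that compute the
conditional expectations given the finite-dimensional projections, and their limit is a measurable
linear transformation extending `Σ_ZV Σ_Z⁻¹`. -/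
theorem exists_regression [CompleteSpace F] {Z : Ω → E} {V : Ω → F}
    (hZV : HasGaussianLaw (fun ω => (Z ω, V ω)) P) (hZm : Measurable Z) (hVm : Measurable V)
    (hZ : MemLp Z 2 P) (hV : MemLp V 2 P) (hZ0 : ∫ ω, Z ω ∂P = 0) (hV0 : ∫ ω, V ω ∂P = 0)
    {W : ℕ → Submodule ℝ E} [∀ m, FiniteDimensional ℝ (W m)] (hW : Monotone W)
    (hWd : ⊤ ≤ (⨆ m, W m).topologicalClosure) :
    ∃ L : E →ₗ.[ℝ] F, IsMeasurableLinear (P.map Z) L ∧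
      (∀ h, ∃ hd : (obs Z hZ).adjoint (obs Z hZ h) ∈ L.domain,
        L ⟨_, hd⟩ = (obs V hV).adjoint (obs Z hZ h)) ∧
      ∀ᵐ ω ∂P, ∃ hd : Z ω ∈ L.domain,
        (P[V | MeasurableSpace.comap Z inferInstance]) ω = L ⟨Z ω, hd⟩ ∧
        Tendsto (fun m => (P[V | projFiltration hZm hW m]) ω) atTop (𝓝 (L ⟨Z ω, hd⟩)) := by
  choose R hR hRW hAR using fun m => exists_adjoint_conj_eq_starProjection (obs Z hZ) (W m)
  set T : ℕ → E →L[ℝ] F := fun m => (obs V hV).adjoint ∘L obs Z hZ ∘L R m with hT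
  have hlevy := tendsto_ae_condExp_banach (projFiltration hZm hW) (hV.integrable one_le_two)
  rw [iSup_projFiltration hZm hW hWd] at hlevy
  have hcond : ∀ᵐ ω ∂P, ∀ m, (P[V | projFiltration hZm hW m]) ω = T m (Z ω) :=
    ae_all_iff.2 fun m =>
      condExp_comap_starProjection hZV hZm hVm hZ hV hZ0 hV0 (W m) (hR m) (hRW m) (hAR m)
  have hconv : ∀ᵐ ω ∂P, Tendsto (fun m => T m (Z ω)) atTop
      (𝓝 ((P[V | MeasurableSpace.comap Z inferInstance]) ω)) := by
    filter_upwards [hlevy, hcond] with ω h1 h2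
    simpa only [h2] using h1
  have hmeas : MeasurableSet {x | ∃ y, Tendsto (fun m => T m x) atTop (𝓝 y)} :=
    measurableSet_exists_tendsto fun m => (T m).continuous.measurable
  refine ⟨limPMap T, isMeasurableLinear_limPMap T ?_, fun h => ?_, ?_⟩
  · rw [ae_map_iff hZm.aemeasurable hmeas]
    exact hconv.mono fun ω h => ⟨_, h⟩
  -- Since A R_m A† projects onto A W_m, T_m A†A h is B† applied to the projection of A h.
  · have hlim : Tendsto (fun m => T m ((obs Z hZ).adjoint (obs Z hZ h))) atTop
        (𝓝 ((obs V hV).adjoint (obs Z hZ h))) := by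
      refine (((obs V hV).adjoint.continuous.tendsto _).comp
        (tendsto_starProjection_map (obs Z hZ) hW hWd h)).congr fun m => ?_
      simp only [Function.comp_apply, ← hAR m]
      rfl
    exact ⟨⟨_, hlim⟩, tendsto_nhds_unique (tendsto_limPMap T ⟨_, _⟩) hlim⟩
  · filter_upwards [hlevy, hconv] with ω h1 h2
    have h3 := tendsto_nhds_unique (tendsto_limPMap T ⟨Z ω, _, h2⟩) h2
    exact ⟨⟨_, h2⟩, h3.symm, by rwa [h3]⟩

end Main

/-! ### Coordinate subspaces of H^n and their σ-algebras -/

section Coordinates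

variable {Ω H : Type*} [NormedAddCommGroup H] [InnerProductSpace ℝ H] {n : ℕ}

/-- The basis vector `e j` in the `i`-th component of `H^n`. -/
def coordVec (e : HilbertBasis ℕ ℝ H) (j : ℕ) (i : Fin n) : HPow H n :=
  WithLp.toLp 2 (Pi.single i (e j))

theorem inner_coordVec (e : HilbertBasis ℕ ℝ H) (x : HPow H n) (j : ℕ) (i : Fin n) :
    inner ℝ x (coordVec e j i) = inner ℝ (x i) (e j) := by
  classical
  rw [PiLp.inner_apply, Finset.sum_eq_single i]
  · simp [coordVec]
  · intro k _ hk
    simp [coordVec, hk]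
  · simp

/-- The span of the first `m` blocks of coordinate vectors of `H^n`. -/
def coordSpan (n : ℕ) (e : HilbertBasis ℕ ℝ H) (m : ℕ) : Submodule ℝ (HPow H n) :=
  Submodule.span ℝ (Set.range fun p : Fin m × Fin n => coordVec e p.1 p.2)

instance (e : HilbertBasis ℕ ℝ H) (m : ℕ) : FiniteDimensional ℝ (coordSpan n e m) :=
  FiniteDimensional.span_of_finite ℝ (Set.finite_range _)

theorem coordVec_mem_coordSpan (e : HilbertBasis ℕ ℝ H) {m j : ℕ} (hj : j < m) (i : Fin n) :
    coordVec e j i ∈ coordSpan n e m :=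
  Submodule.subset_span ⟨(⟨j, hj⟩, i), rfl⟩

theorem monotone_coordSpan (n : ℕ) (e : HilbertBasis ℕ ℝ H) : Monotone (coordSpan n e) := by
  intro m k hmk
  refine Submodule.span_le.2 ?_
  rintro _ ⟨⟨j, i⟩, rfl⟩
  exact coordVec_mem_coordSpan e (j.2.trans_le hmk) i

theorem dense_iSup_coordSpan [CompleteSpace H] (n : ℕ) (e : HilbertBasis ℕ ℝ H) :
    ⊤ ≤ (⨆ m, coordSpan n e m).topologicalClosure := by
  rw [top_le_iff, Submodule.topologicalClosure_eq_top_iff, Submodule.eq_bot_iff]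
  intro x hx
  have h0 : ∀ i j, inner ℝ (x i) (e j) = 0 := fun i j => by
    rw [← inner_coordVec, real_inner_comm]
    exact hx _ (Submodule.mem_iSup_of_mem (j + 1) (coordVec_mem_coordSpan e j.lt_succ_self i))
  ext1 i
  have h1 := (hasSum_sq_inner e (x i))
  have h2 : (fun j => inner ℝ (e j) (x i) ^ 2) = fun _ => (0 : ℝ) := by
    funext j
    rw [real_inner_comm, h0, zero_pow two_ne_zero]
  rw [h2] at h1
  simpa using h1.unique hasSum_zero

theorem starProjection_coordSpan (e : HilbertBasis ℕ ℝ H) (m : ℕ) (z : HPow H n) :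
    (coordSpan n e m).starProjection z =
      ∑ p : Fin m × Fin n, (inner ℝ (z p.2) (e p.1) : ℝ) • coordVec e p.1 p.2 := by
  classical
  refine Submodule.eq_starProjection_of_mem_of_inner_eq_zero ?_ fun w hw => ?_
  · exact Submodule.sum_mem _ fun p _ =>
      Submodule.smul_mem _ _ (coordVec_mem_coordSpan e p.1.2 p.2)
  · induction hw using Submodule.span_induction with
    | zero => exact inner_zero_right _
    | add u v _ _ hu hv => rw [inner_add_right, hu, hv, add_zero]
    | smul c u _ hu => rw [inner_smul_right, hu, mul_zero]
    | mem u hu =>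
      obtain ⟨⟨k, l⟩, rfl⟩ := hu
      rw [inner_sub_left, inner_coordVec, sum_inner, sub_eq_zero, Finset.sum_eq_single (k, l)]
      · simp [inner_smul_left, coordVec, e.orthonormal.1]
      · rintro ⟨j, i⟩ - hne
        rw [inner_smul_left, inner_coordVec]
        by_cases hi : l = i
        · subst hi
          have hjk : (j : ℕ) ≠ k := fun h => hne (by rw [Fin.ext h])
          simp [coordVec, e.orthonormal.2 hjk]
        · simp [coordVec, hi]
      · simp

/-- The coordinates and the projection of X - c determine each other through continuous maps, the
shift by the coordinates of c being deterministic. -/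
theorem coordSigma_eq_comap [MeasurableSpace H] [BorelSpace H] [SecondCountableTopology H]
    (e : HilbertBasis ℕ ℝ H) (X : Ω → HPow H n) (c : HPow H n) (m : ℕ) :
    coordSigma e X m =
      MeasurableSpace.comap (fun ω => (coordSpan n e m).starProjection (X ω - c)) inferInstance := by
  refine le_antisymm ?_ ?_
  · set g : HPow H n → Fin m → Fin n → ℝ := fun y j i =>
      inner ℝ y (coordVec e j i) + inner ℝ c (coordVec e j i) with hg
    have hgm : Measurable g := measurable_pi_lambda _ fun j => measurable_pi_lambda _ fun i =>
      (Continuous.measurable (by fun_prop))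
    have h : (fun ω (j : Fin m) (i : Fin n) => (inner ℝ (X ω i) (e j) : ℝ)) =
        g ∘ fun ω => (coordSpan n e m).starProjection (X ω - c) := by
      funext ω j i
      simp only [Function.comp_apply, hg]
      rw [Submodule.inner_starProjection_left_eq_right, Submodule.starProjection_eq_self_iff.2
        (coordVec_mem_coordSpan e j.2 i), ← inner_add_left, sub_add_cancel, inner_coordVec]
    rw [coordSigma, h, ← MeasurableSpace.comap_comp]
    exact MeasurableSpace.comap_mono hgm.comap_le
  · set g : (Fin m → Fin n → ℝ) → HPow H n := fun a =>
      ∑ p : Fin m × Fin n, (a p.1 p.2 - inner ℝ (c p.2) (e p.1)) • coordVec e p.1 p.2 with hg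
    have hgm : Measurable g := Continuous.measurable (by fun_prop)
    have h : (fun ω => (coordSpan n e m).starProjection (X ω - c)) =
        g ∘ fun ω (j : Fin m) (i : Fin n) => (inner ℝ (X ω i) (e j) : ℝ) := by
      funext ω
      rw [starProjection_coordSpan]
      simp only [Function.comp_apply, hg, PiLp.sub_apply, inner_sub_left]
    rw [h, ← MeasurableSpace.comap_comp]
    exact MeasurableSpace.comap_mono hgm.comap_le

end Coordinates

/-! ### Centring, and extensions described without inverses -/

section Assembly

theorem comap_sub_const {Ω E : Type*} [NormedAddCommGroup E] [MeasurableSpace E] [BorelSpace E]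
    (X : Ω → E) (c : E) :
    MeasurableSpace.comap (fun ω => X ω - c) inferInstance =
      MeasurableSpace.comap X inferInstance := by
  have h := (Homeomorph.subRight c).toMeasurableEquiv.measurableEmbedding.comap_eq
  change MeasurableSpace.comap ((fun x => x - c) ∘ X) _ = _
  rw [← MeasurableSpace.comap_comp]
  exact congrArg (MeasurableSpace.comap X) h

theorem hasGaussianLaw_sub_const {Ω E : Type*} [MeasurableSpace Ω] {P : Measure Ω}
    [NormedAddCommGroup E] [NormedSpace ℝ E] [MeasurableSpace E] [BorelSpace E]
    [SecondCountableTopology E] {X : Ω → E} (hX : HasGaussianLaw X P) (c : E) :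
    HasGaussianLaw (fun ω => X ω - c) P where
  isGaussian_map := by
    have := hX.isGaussian_map
    have h : P.map (fun ω => X ω - c) = (P.map X).map (fun x => x - c) := by
      rw [AEMeasurable.map_map_of_aemeasurable (by fun_prop) hX.aemeasurable]
      rfl
    rw [h]
    infer_instance

theorem condExp_sub_const {Ω F : Type*} {m m0 : MeasurableSpace Ω} {P : Measure Ω}
    [IsFiniteMeasure P] [NormedAddCommGroup F] [NormedSpace ℝ F] [CompleteSpace F] {Y : Ω → F}
    (hm : m ≤ m0) (hY : Integrable Y P) (c : F) :
    P[Y | m] =ᵐ[P] fun ω => c + (P[fun ω => Y ω - c | m]) ω := by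
  filter_upwards [condExp_sub hY (integrable_const c) m] with ω h
  have h' : (P[fun ω => Y ω - c | m]) ω = (P[Y | m]) ω - c := by
    rw [condExp_const hm c] at h
    exact h
  rw [h', add_sub_cancel]

/-- The preimage x of A†A h chosen by the inverse may differ from h, but A†A (x - h) = 0 forces A (x
- h) = 0, so B†A x = B†A h. -/
theorem mulInv_adjoint_comp_le_iff {E F K : Type*}
    [NormedAddCommGroup E] [InnerProductSpace ℝ E] [CompleteSpace E]
    [NormedAddCommGroup F] [InnerProductSpace ℝ F] [CompleteSpace F]
    [NormedAddCommGroup K] [InnerProductSpace ℝ K] [CompleteSpace K]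
    (A : E →L[ℝ] K) (B : F →L[ℝ] K) (L : E →ₗ.[ℝ] F) :
    mulInv (B.adjoint ∘L A) (A.adjoint ∘L A) ≤ L ↔
      ∀ h, ∃ hd : A.adjoint (A h) ∈ L.domain, L ⟨_, hd⟩ = B.adjoint (A h) := by
  have hdom : (mulInv (B.adjoint ∘L A) (A.adjoint ∘L A)).domain =
      LinearMap.range ((A.adjoint ∘L A : E →L[ℝ] E) : E →ₗ[ℝ] E) := opInv_domain _
  constructor
  · intro hle h
    have hd : A.adjoint (A h) ∈ (mulInv (B.adjoint ∘L A) (A.adjoint ∘L A)).domain := by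
      rw [hdom]; exact ⟨h, rfl⟩
    refine ⟨hle.1 hd, ?_⟩
    rw [← hle.2 (x := ⟨_, hd⟩) (y := ⟨_, hle.1 hd⟩) rfl]
    obtain ⟨x, hx, hval⟩ := mulInv_apply _ _ ⟨_, hd⟩
    rw [hval]
    have hx' : A.adjoint (A (x - h)) = 0 := by
      rw [map_sub, map_sub, sub_eq_zero]; exact hx
    have h0 : A (x - h) = 0 := by
      rw [← inner_self_eq_zero (𝕜 := ℝ), ← ContinuousLinearMap.adjoint_inner_left, hx',
        inner_zero_left]
    rw [map_sub, sub_eq_zero] at h0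
    rw [ContinuousLinearMap.comp_apply, h0]
  · intro hL
    refine ⟨fun y hy => ?_, ?_⟩
    · rw [hdom] at hy
      obtain ⟨h, rfl⟩ := hy
      exact (hL h).1
    · rintro y ⟨z, hz⟩ rfl
      obtain ⟨x, hx, hval⟩ := mulInv_apply _ _ y
      obtain ⟨hd, hLx⟩ := hL x
      rw [hval, ContinuousLinearMap.comp_apply, ← hLx]
      congr 1
      exact Subtype.ext hx

end Assembly

end GaussCond

end

open GaussCond in
theorem proposition3
    {H : Type*} [NormedAddCommGroup H] [InnerProductSpace ℝ H] [CompleteSpace H]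
    [SecondCountableTopology H] [MeasurableSpace H] [BorelSpace H]
    (e : HilbertBasis ℕ ℝ H) (n : ℕ)
    {Ω : Type*} [MeasurableSpace Ω] (P : Measure Ω) [IsProbabilityMeasure P]
    (X Y : Ω → HPow H n) (hX : Measurable X) (hY : Measurable Y)
    (hXY : HasGaussianLaw (fun ω => (X ω, Y ω)) P) :
    -- `T = Σ_XY Σ_X^{-1/2}` is Hilbert–Schmidt
    (∃ S, IsPosSqrt S (cov P X) ∧ IsHilbertSchmidtPMap (mulInv (crossCov P X Y) S)) ∧
    -- `Σ_XY Σ_X^{-1}` extends to a measurable linear transformation for the law of `X - E X`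
    (∃ L : HPow H n →ₗ.[ℝ] HPow H n,
      IsMeasurableLinear (P.map fun ω => X ω - ∫ ω', X ω' ∂P) L ∧
      mulInv (crossCov P X Y) (cov P X) ≤ L) ∧
    -- and for every such extension the formula holds almost surely, as the limit of the
    -- conditional expectations given the first `m` coordinate blocks
    (∀ L : HPow H n →ₗ.[ℝ] HPow H n,
      IsMeasurableLinear (P.map fun ω => X ω - ∫ ω', X ω' ∂P) L →
      mulInv (crossCov P X Y) (cov P X) ≤ L →
      ∀ᵐ ω ∂P, ∃ hω : X ω - ∫ ω', X ω' ∂P ∈ L.domain,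
        (P[Y | MeasurableSpace.comap X inferInstance]) ω
            = (∫ ω', Y ω' ∂P) + L ⟨X ω - ∫ ω', X ω' ∂P, hω⟩ ∧
        Tendsto (fun m => (P[Y | coordSigma e X m]) ω) atTop
          (𝓝 ((∫ ω', Y ω' ∂P) + L ⟨X ω - ∫ ω', X ω' ∂P, hω⟩))) := by
  have hX2 : MemLp X 2 P := hXY.fst.memLp_two
  have hY2 : MemLp Y 2 P := hXY.snd.memLp_two
  have hYi : Integrable Y P := hY2.integrable one_le_two
  set c := ∫ ω', X ω' ∂P with hc
  set d := ∫ ω', Y ω' ∂P with hd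
  set Z : Ω → HPow H n := fun ω => X ω - c with hZdef
  set V : Ω → HPow H n := fun ω => Y ω - d with hVdef
  have hZ : MemLp Z 2 P := hX2.sub (memLp_const c)
  have hV : MemLp V 2 P := hY2.sub (memLp_const d)
  have hZm : Measurable Z := hX.sub_const c
  have hVm : Measurable V := hY.sub_const d
  have hZV : HasGaussianLaw (fun ω => (Z ω, V ω)) P := hasGaussianLaw_sub_const hXY (c, d)
  have hZ0 : ∫ ω, Z ω ∂P = 0 := by
    rw [integral_sub (hX2.integrable one_le_two) (integrable_const c)]
    simp [hc]
  have hV0 : ∫ ω, V ω ∂P = 0 := by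
    rw [integral_sub hYi (integrable_const d)]
    simp [hd]
  have hcov : cov P X = (obs Z hZ).adjoint ∘L obs Z hZ := crossCov_eq_adjoint_comp hX2 hX2 hZ hZ
  have hcross : crossCov P X Y = (obs V hV).adjoint ∘L obs Z hZ :=
    crossCov_eq_adjoint_comp hX2 hY2 hZ hV
  rw [hcov, hcross]
  have hW := monotone_coordSpan n e
  have hWd := dense_iSup_coordSpan n e
  obtain ⟨L₀, hL₀, hext₀, hreg⟩ := exists_regression hZV hZm hVm hZ hV hZ0 hV0 hW hWd
  refine ⟨?_, ⟨L₀, hL₀, (mulInv_adjoint_comp_le_iff _ _ _).2 hext₀⟩, fun L hL hext => ?_⟩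
  · obtain ⟨S, hS⟩ := exists_isPosSqrt_adjoint_comp_self (obs Z hZ)
    obtain ⟨s, b, -⟩ := exists_hilbertBasis ℝ (HPow H n)
    exact ⟨S, hS, isHilbertSchmidtPMap_mulInv_sqrt b _ _ (summable_norm_obs_sq hV b) hS⟩
  · rw [mulInv_adjoint_comp_le_iff] at hext
    -- On the intersection of the domains L - L₀ is measurable linear and vanishes on the range of
    -- Σ_X, so L inherits the formula and the limit proved for L₀.
    have hzero := ae_eq_zero_of_isMeasurableLinear hZm hZV.fst hZ hZ0 hW hWd (hL.sub hL₀)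
      fun h => by
        obtain ⟨h1, h2⟩ := hext h
        obtain ⟨h3, h4⟩ := hext₀ h
        exact ⟨⟨h1, h3⟩, by rw [LinearPMap.sub_apply, h2, h4, sub_self]⟩
    have hdom : ∀ᵐ ω ∂P, Z ω ∈ L.domain := ae_of_ae_map hZm.aemeasurable hL.2.1
    have hfil : ∀ m, projFiltration hZm hW m = coordSigma e X m := fun m =>
      (coordSigma_eq_comap e X c m).symm
    have hfull := condExp_sub_const hX.comap_le hYi d
    have hfin : ∀ᵐ ω ∂P, ∀ m, (P[Y | projFiltration hZm hW m]) ω =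
        d + (P[V | projFiltration hZm hW m]) ω :=
      ae_all_iff.2 fun m => condExp_sub_const ((projFiltration hZm hW).le m) hYi d
    rw [comap_sub_const X c] at hreg
    filter_upwards [hzero, hdom, hreg, hfull, hfin] with ω h0 hω hr hf hm
    obtain ⟨hω₀, hr1, hr2⟩ := hr
    have heq : L ⟨Z ω, hω⟩ = L₀ ⟨Z ω, hω₀⟩ := by
      have := h0 ⟨hω, hω₀⟩
      rwa [LinearPMap.sub_apply, sub_eq_zero] at this
    refine ⟨hω, ?_, ?_⟩
    · rw [hf, heq, ← hr1]
    · simp_rw [← hfil, hm]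
      rw [heq]
      exact hr2.const_add d
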